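/- A weighted graph $G=(V,F,w)$ consists of a finite vertex set $V$, a finite set $F$ of edges, each joining two distinct vertices (parallel edges are allowed), and weights $w:F\to[0,\infty)$. It is called connected if $V\neq\emptyset$ and any two vertices are joined by a path of edges of positive weight. Its Laplacian $L_G\in\mathbb R^{V\times V}$ has as diagonal entry at $u$ the total weight of the edges incident to $u$, and as entry at $(u,v)$ with $u\ne v$ minus the total weight of the edges joining $u$ and $v$. For an edge, or potential new edge, $f$ with endpoints $u\neq v$, the effective resistance is $R_G(f)=(\chi_u-\chi_v)^\top L_G^{+}(\chi_u-\chi_v)$, where $L_G^+$ is the Moore–Penrose pseudo-inverse and $\chi_u$ is the indicator vector of $u$. The spanning tree potential of a connected weighted graph $G$ is $$\Psi(G)=\log\Bigl(\sum_{T}\ \prod_{g\in T}w(g)\Bigr),$$ the sum being over all (edge sets of) spanning trees $T\subseteq F$ of the graph $(V,F)$. For $\lambda\in\mathbb R$, let $G+\lambda\cdot f$ be the weighted graph obtained from $G$ as follows: if $f\in F$, the weight of $f$ is replaced by $w(f)+\lambda$; if $f\notin F$, the edge $f$ is added to $F$ with weight $\lambda$; all other weights are unchanged. It is well defined if $\lambda\ge0$,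 or if $\lambda<0$, $f\in F$ and $w(f)\ge|\lambda|$. **Lemma.** Let $G$ be a connected weighted graph, let $\lambda\in\mathbb R$, and let $f$ be an edge of $G$ or a potential new edge between two distinct vertices of $G$, such that $G+\lambda\cdot f$ is well defined and connected. Then $1+\lambda R_G(f)>0$ and $$\Psi(G+\lambda\cdot f)=\Psi(G)+\log\bigl(1+\lambda R_G(f)\bigr).$$ -/

import Mathlib

open scoped Matrix

/-! ### The Moore–Penrose pseudo-inverse of a real matrix -/

/-- `X` satisfies the four Penrose conditions with respect to `A`. -/
structure IsMoorePenrose {m n : Type*} [Fintype m] [Fintype n]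
    (A : Matrix m n ℝ) (X : Matrix n m ℝ) : Prop where
  mul_mul_left : A * X * A = A
  mul_mul_right : X * A * X = X
  left_symm : (A * X)ᵀ = A * X
  right_symm : (X * A)ᵀ = X * A

theorem IsMoorePenrose.unique {m n : Type*} [Fintype m] [Fintype n]
    {A : Matrix m n ℝ} {X Y : Matrix n m ℝ} (hX : IsMoorePenrose A X) (hY : IsMoorePenrose A Y) :
    X = Y := by
  have h1 : A * X = A * Y := by
    calc A * X = (A * X)ᵀ := hX.left_symm.symm
      _ = ((A * Y) * (A * X))ᵀ := by rw [← Matrix.mul_assoc, hY.mul_mul_left]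
      _ = (A * X)ᵀ * (A * Y)ᵀ := Matrix.transpose_mul _ _
      _ = (A * X * A) * Y := by rw [hX.left_symm, hY.left_symm, Matrix.mul_assoc (A * X) A Y]
      _ = A * Y := by rw [hX.mul_mul_left]
  have h2 : X * A = Y * A := by
    calc X * A = (X * A)ᵀ := hX.right_symm.symm
      _ = ((X * A) * (Y * A))ᵀ := by
          rw [Matrix.mul_assoc X A (Y * A), ← Matrix.mul_assoc A Y A, hY.mul_mul_left]
      _ = (Y * A)ᵀ * (X * A)ᵀ := Matrix.transpose_mul _ _
      _ = Y * (A * X * A) := by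
          rw [hX.right_symm, hY.right_symm, Matrix.mul_assoc Y A (X * A), Matrix.mul_assoc A X A]
      _ = Y * A := by rw [hX.mul_mul_left]
  calc X = X * A * X := hX.mul_mul_right.symm
    _ = Y * (A * X) := by rw [h2, Matrix.mul_assoc]
    _ = Y * A * Y := by rw [h1, Matrix.mul_assoc]
    _ = Y := hY.mul_mul_right

theorem exists_isMoorePenrose_of_isHermitian {n : Type*} [Fintype n]
    {A : Matrix n n ℝ} (hA : A.IsHermitian) : ∃ X : Matrix n n ℝ, IsMoorePenrose A X ∧ Xᵀ = X := by
  classical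
  obtain ⟨U, d, hU, hAU⟩ : ∃ (U : Matrix n n ℝ) (d : n → ℝ),
      Uᵀ * U = 1 ∧ A = U * Matrix.diagonal d * Uᵀ := by
    refine ⟨hA.eigenvectorUnitary, hA.eigenvalues, ?_, ?_⟩
    · simpa [Matrix.star_eq_conjTranspose] using Unitary.coe_star_mul_self hA.eigenvectorUnitary
    · have h := hA.spectral_theorem
      rw [Unitary.conjStarAlgAut_apply] at h
      simpa [Matrix.star_eq_conjTranspose, Function.comp_def] using h
  have key : ∀ a b : n → ℝ, (U * Matrix.diagonal a * Uᵀ) * (U * Matrix.diagonal b * Uᵀ)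
      = U * Matrix.diagonal (fun i => a i * b i) * Uᵀ := by
    intro a b
    calc _ = U * Matrix.diagonal a * (Uᵀ * U) * Matrix.diagonal b * Uᵀ := by
            simp only [Matrix.mul_assoc]
      _ = _ := by rw [hU, Matrix.mul_one, Matrix.mul_assoc U, Matrix.diagonal_mul_diagonal]
  have tr : ∀ a : n → ℝ, (U * Matrix.diagonal a * Uᵀ)ᵀ = U * Matrix.diagonal a * Uᵀ := by
    intro a
    simp [Matrix.transpose_mul, Matrix.mul_assoc]
  refine ⟨U * Matrix.diagonal (fun i => (d i)⁻¹) * Uᵀ, ⟨?_, ?_, ?_, ?_⟩, tr _⟩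
  · rw [hAU, key, key]
    congr 3
    funext i
    exact mul_inv_mul_cancel (d i)
  · rw [hAU, key, key]
    congr 3
    funext i
    simpa using mul_inv_mul_cancel (d i)⁻¹
  · rw [hAU, key, tr]
  · rw [hAU, key, tr]

theorem exists_isMoorePenrose {m n : Type*} [Fintype m] [Fintype n] (A : Matrix m n ℝ) :
    ∃ X : Matrix n m ℝ, IsMoorePenrose A X := by
  classical
  obtain ⟨P, hP, hPt⟩ := exists_isMoorePenrose_of_isHermitian
    (Matrix.isHermitian_conjTranspose_mul_self A)
  rw [Matrix.conjTranspose_eq_transpose_of_trivial] at hP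
  have hA : A * P * (Aᵀ * A) = A := by
    have h0 : Aᵀ * A * (P * (Aᵀ * A) - (1 : Matrix n n ℝ)) = 0 := by
      rw [Matrix.mul_sub, ← Matrix.mul_assoc, hP.mul_mul_left, Matrix.mul_one, sub_self]
    have h1 : A * (P * (Aᵀ * A) - (1 : Matrix n n ℝ)) = 0 := by
      rw [← Matrix.conjTranspose_eq_transpose_of_trivial] at h0
      exact (Matrix.conjTranspose_mul_self_mul_eq_zero A _).1 h0
    rw [Matrix.mul_sub, Matrix.mul_one, sub_eq_zero] at h1
    rw [Matrix.mul_assoc, h1]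
  refine ⟨P * Aᵀ, ⟨?_, ?_, ?_, ?_⟩⟩
  · rw [← Matrix.mul_assoc, Matrix.mul_assoc (A * P), hA]
  · calc P * Aᵀ * A * (P * Aᵀ) = P * (Aᵀ * A) * P * Aᵀ := by simp only [Matrix.mul_assoc]
      _ = P * Aᵀ := by rw [hP.mul_mul_right]
  · simp [Matrix.transpose_mul, hPt, Matrix.mul_assoc]
  · rw [Matrix.mul_assoc, hP.right_symm]

/-- The Moore–Penrose pseudo-inverse `A⁺`: the unique matrix satisfying the Penrose conditions. -/
noncomputable def moorePenroseInverse {m n : Type*} [Fintype m] [Fintype n]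
    (A : Matrix m n ℝ) : Matrix n m ℝ :=
  (exists_isMoorePenrose A).choose

theorem moorePenroseInverse_spec {m n : Type*} [Fintype m] [Fintype n] (A : Matrix m n ℝ) :
    IsMoorePenrose A (moorePenroseInverse A) :=
  (exists_isMoorePenrose A).choose_spec

/-! ### Weighted graphs -/

/-- A weighted (ordinary) graph `(V, F, w)` on the vertex set `V`, parallel edges being allowed.
The elements of `E` are names for possible edges, each with a pair of distinct endpoints in `V`.
The finite set `edges` is the edge set `F` of the graph, and `weight` restricted to `edges` is
its nonnegative weight function; the value of `weight` outside `edges` is never used.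
Graphs without parallel edges are the case `E = {e : Sym2 V // ¬ e.IsDiag}` with `ends e = e`. -/
structure WeightedGraph (V E : Type*) where
  ends : E → Sym2 V
  ends_not_isDiag : ∀ e, ¬ (ends e).IsDiag
  edges : Finset E
  weight : E → ℝ
  weight_nonneg : ∀ e ∈ edges, 0 ≤ weight e

namespace WeightedGraph

/-- The graph is connected, where edges of weight zero do not count as connections: any two
vertices are joined by a path of edges of positive weight (and there is at least one vertex). -/
def Connected {V E : Type*} (G : WeightedGraph V E) : Prop :=
  (SimpleGraph.fromEdgeSet (G.ends '' {e | e ∈ G.edges ∧ 0 < G.weight e})).Connected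

/-- The weighted degree of `u`: the sum of the weights of all edges incident to `u`. -/
def degree {V E : Type*} [DecidableEq V] (G : WeightedGraph V E) (u : V) : ℝ :=
  ∑ e ∈ G.edges with u ∈ G.ends e, G.weight e

/-- The Laplacian: weighted degrees on the diagonal, and off the diagonal minus the weight of the
edge (with parallel edges: minus the total weight of the edges) joining the two vertices. -/
def laplacian {V E : Type*} [DecidableEq V] (G : WeightedGraph V E) : Matrix V V ℝ :=
  Matrix.of fun u v =>
    if u = v then G.degree u else - ∑ e ∈ G.edges with G.ends e = s(u, v), G.weight e

/-- The effective resistance `(χ_u - χ_v)ᵀ L⁺ (χ_u - χ_v)` of a pair of vertices. -/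
noncomputable def effectiveResistance {V E : Type*} [Fintype V] [DecidableEq V]
    (G : WeightedGraph V E) (u v : V) : ℝ :=
  (Pi.single u 1 - Pi.single v 1) ⬝ᵥ
    (moorePenroseInverse G.laplacian *ᵥ (Pi.single u 1 - Pi.single v 1))

theorem effectiveResistance_comm {V E : Type*} [Fintype V] [DecidableEq V]
    (G : WeightedGraph V E) (u v : V) :
    G.effectiveResistance u v = G.effectiveResistance v u := by
  have h : (Pi.single v 1 - Pi.single u 1 : V → ℝ) = -(Pi.single u 1 - Pi.single v 1) := by
    rw [neg_sub]
  unfold effectiveResistance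
  rw [h, Matrix.mulVec_neg, neg_dotProduct, dotProduct_neg, neg_neg]

/-- The effective resistance `R_G(f)` of (the pair of endpoints of) `f`. -/
noncomputable def edgeResistance {V E : Type*} [Fintype V] [DecidableEq V]
    (G : WeightedGraph V E) (f : E) : ℝ :=
  Sym2.lift ⟨G.effectiveResistance, G.effectiveResistance_comm⟩ (G.ends f)

/-- `T` is (the edge set of) a spanning tree of `G`: the graph `(V, T)` has no parallel edges, is
connected and has no cycles. -/
def IsSpanningTree {V E : Type*} (G : WeightedGraph V E) (T : Finset E) : Prop :=
  T ⊆ G.edges ∧ Set.InjOn G.ends T ∧ (SimpleGraph.fromEdgeSet (G.ends '' T)).IsTree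

open Classical in
/-- The set of all spanning trees of `G`. -/
noncomputable def spanningTrees {V E : Type*} (G : WeightedGraph V E) : Finset (Finset E) :=
  {T ∈ G.edges.powerset | G.IsSpanningTree T}

/-- The spanning tree potential `Ψ(G)`. -/
noncomputable def stPotential {V E : Type*} (G : WeightedGraph V E) : ℝ :=
  Real.log (∑ T ∈ G.spanningTrees, ∏ f ∈ T, G.weight f)

/-- `G + lam • f` is well defined as a weighted graph: if `lam` is negative, then `f` must be
present in `G` with weight at least `|lam|`. -/
def UpdateValid {V E : Type*} (G : WeightedGraph V E) (lam : ℝ) (f : E) : Prop :=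
  lam < 0 → f ∈ G.edges ∧ |lam| ≤ G.weight f

/-- The weighted graph `G + lam • f`: if `f` is an edge of `G`, its weight is increased by `lam`;
otherwise `f` is added to the edge set with weight `lam`. -/
def update {V E : Type*} [DecidableEq E] (G : WeightedGraph V E) (lam : ℝ) (f : E)
    (h : G.UpdateValid lam f) : WeightedGraph V E where
  ends := G.ends
  ends_not_isDiag := G.ends_not_isDiag
  edges := insert f G.edges
  weight := Function.update G.weight f (if f ∈ G.edges then G.weight f + lam else lam)
  weight_nonneg := by
    intro e he
    by_cases hef : e = f
    · subst hef
      rw [Function.update_self]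
      rcases lt_or_ge lam 0 with hl | hl
      · obtain ⟨hm, hw⟩ := h hl
        rw [if_pos hm]
        rw [abs_of_neg hl] at hw
        linarith
      · split_ifs with hm
        · exact add_nonneg (G.weight_nonneg _ hm) hl
        · exact hl
    · rw [Function.update_of_ne hef]
      exact G.weight_nonneg e (Finset.mem_of_mem_insert_of_ne he hef)

end WeightedGraph

/-! ### The Cauchy–Binet expansion of a weighted sum of rank-one matrices -/

section CauchyBinet

variable {n E R : Type*} [Fintype n] [DecidableEq n] [DecidableEq E] [CommRing R]

/-! Fix a vertex `r` and delete its row and column from the Laplacian. By the weighted matrix-tree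
theorem the remaining determinant is the spanning tree sum. Passing to `G + lam • f` adds the
rank-one matrix `lam • b bᵀ`, with `b` the signed incidence vector of `f` off `r`, so by the matrix
determinant lemma the tree sum is multiplied by `1 + lam * (bᵀ L_r⁻¹ b)`. That quadratic form is the
effective resistance, because a potential grounded at `r` solves the full Laplacian system. Both
tree sums are positive by connectedness; hence the factor is positive and the logarithms add.

The matrix-tree theorem comes from a Cauchy–Binet expansion over edge sets `S` of size `|V| - 1`:
the unit-weight reduced determinant of `S` is 1 if `S` connects the graph and 0 otherwise. -/

theorem det_sum_mul_eq_sum_injective (F : Finset E) (c b : E → n → R) :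
    (Matrix.of fun i j => ∑ e ∈ F, c e i * b e j).det =
      ∑ p ∈ Fintype.piFinset (fun _ : n => F) with Function.Injective p,
        (∏ i, c (p i) i) * (Matrix.of fun i => b (p i)).det := by
  have hrows : (Matrix.of fun i j => ∑ e ∈ F, c e i * b e j) =
      (fun i => ∑ e ∈ F, c e i • b e : n → n → R) := by
    funext i j
    simp [Finset.sum_apply]
  have h := (Matrix.detRowAlternating (n := n) (R := R)).toMultilinearMap.map_sum_finset
    (fun i e => c e i • b e) (fun _ => F)
  -- Multilinearity expands over all `p`; a non-injective `p` repeats a row and contributes zero.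
  rw [Finset.sum_filter_of_ne]
  · calc _ = Matrix.detRowAlternating (fun i => ∑ e ∈ F, c e i • b e : n → n → R) := by
          rw [hrows]; rfl
      _ = _ := h
      _ = _ := Finset.sum_congr rfl fun p _ =>
          (Matrix.detRowAlternating (n := n) (R := R)).toMultilinearMap.map_smul_univ
            (fun i => c (p i) i) (fun i => b (p i))
  · intro p _ hp i j hij
    by_contra hne
    apply hp
    rw [Matrix.det_zero_of_row_eq hne (congrArg b hij), mul_zero]

/-- Group the injective `p` by their image `S`. The weights factor out, and what remains is the same
expansion for `S` with unit weights, so no ordering of `S` or square minor has to be chosen. -/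
theorem det_sum_smul_eq_sum_powersetCard (F : Finset E) (w : E → R) (b : E → n → R) :
    (Matrix.of fun i j => ∑ e ∈ F, w e * (b e i * b e j)).det =
      ∑ S ∈ F.powersetCard (Fintype.card n),
        (∏ e ∈ S, w e) * (Matrix.of fun i j => ∑ e ∈ S, b e i * b e j).det := by
  have h := det_sum_mul_eq_sum_injective F (fun e i => w e * b e i) b
  simp only [mul_assoc] at h
  rw [h, ← Finset.sum_fiberwise_of_maps_to (t := F.powersetCard (Fintype.card n))
    (g := fun p => Finset.univ.image p)]
  · refine Finset.sum_congr rfl fun S hS => ?_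
    obtain ⟨hSF, hS⟩ := Finset.mem_powersetCard.1 hS
    rw [det_sum_mul_eq_sum_injective, Finset.mul_sum]
    have himage : ∀ p : n → E, Function.Injective p →
        (Finset.univ.image p = S ↔ ∀ i, p i ∈ S) := by
      intro p hp
      constructor
      · rintro rfl i
        exact Finset.mem_image_of_mem _ (Finset.mem_univ i)
      · intro hpS
        refine Finset.eq_of_subset_of_card_le (Finset.image_subset_iff.2 fun i _ => hpS i) ?_
        rw [Finset.card_image_of_injective _ hp, hS, Finset.card_univ]
    refine Finset.sum_congr ?_ ?_
    · ext p
      simp only [Finset.mem_filter, Fintype.mem_piFinset]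
      constructor
      · rintro ⟨⟨_, hp⟩, hpS⟩
        exact ⟨(himage p hp).1 hpS, hp⟩
      · rintro ⟨hpS, hp⟩
        exact ⟨⟨fun i => hSF (hpS i), hp⟩, (himage p hp).2 hpS⟩
    · intro p hpm
      simp only [Finset.mem_filter, Fintype.mem_piFinset] at hpm
      obtain ⟨hpS, hp⟩ := hpm
      rw [← (himage p hp).2 hpS, Finset.prod_image fun i _ j _ hij => hp hij,
        Finset.prod_mul_distrib, mul_assoc]
  · intro p hpm
    simp only [Finset.mem_filter, Fintype.mem_piFinset] at hpm
    rw [Finset.mem_powersetCard]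
    refine ⟨Finset.image_subset_iff.2 fun i _ => hpm.1 i, ?_⟩
    rw [Finset.card_image_of_injective _ hpm.2, Finset.card_univ]

end CauchyBinet

namespace WeightedGraph

theorem sum_spanningTrees_pos {V E : Type*} (G : WeightedGraph V E) (hG : G.Connected) :
    0 < ∑ T ∈ G.spanningTrees, ∏ e ∈ T, G.weight e := by
  classical
  have hnonneg : ∀ T ∈ G.spanningTrees, 0 ≤ ∏ e ∈ T, G.weight e := by
    intro T hT
    have hTE := Finset.mem_powerset.1 (Finset.mem_filter.1 hT).1
    exact Finset.prod_nonneg fun e he => G.weight_nonneg e (hTE he)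
  obtain ⟨H, hHG, hH⟩ := SimpleGraph.Connected.exists_isTree_le hG
  set P : Set E := {e | e ∈ G.edges ∧ 0 < G.weight e} with hP
  -- Among parallel edges of positive weight, pick one for each edge of the tree `H`.
  obtain ⟨S, hS, hbij⟩ := Set.exists_subset_bijOn (P ∩ G.ends ⁻¹' H.edgeSet) G.ends
  have himage : G.ends '' S = H.edgeSet := by
    rw [hbij.image_eq, Set.image_inter_preimage, Set.inter_eq_right]
    intro a ha
    have := SimpleGraph.edgeSet_mono hHG ha
    rw [SimpleGraph.edgeSet_fromEdgeSet] at this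
    exact this.1
  have hfin : S.Finite := G.edges.finite_toSet.subset fun e he => (hS he).1.1
  lift S to Finset E using hfin
  have hSE : S ⊆ G.edges := fun e he => (hS he).1.1
  have hmem : S ∈ G.spanningTrees := by
    refine Finset.mem_filter.2 ⟨Finset.mem_powerset.2 hSE, hSE, hbij.injOn, ?_⟩
    rwa [himage, SimpleGraph.fromEdgeSet_edgeSet]
  exact (Finset.prod_pos fun e he => (hS he).1.2).trans_le
    (Finset.single_le_sum hnonneg hmem)

variable {V E : Type*} [DecidableEq V]

/-! ### Signed incidence vectors -/

/-- The signed incidence vector `χ_u - χ_v` of an edge, for a chosen orientation. -/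
noncomputable def incidence (R : Type*) [Ring R] (G : WeightedGraph V E) (e : E) : V → R :=
  Pi.single (G.ends e).out.1 1 - Pi.single (G.ends e).out.2 1

theorem exists_incidence_eq (R : Type*) [Ring R] (G : WeightedGraph V E) (e : E) :
    ∃ u v, u ≠ v ∧ G.ends e = s(u, v) ∧
      G.incidence R e = Pi.single u 1 - Pi.single v 1 := by
  have h : G.ends e = s((G.ends e).out.1, (G.ends e).out.2) := (Quot.out_eq (G.ends e)).symm
  refine ⟨_, _, fun huv => ?_, h, rfl⟩
  apply G.ends_not_isDiag e
  rw [h, huv]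
  exact rfl

theorem intCast_incidence (R : Type*) [Ring R] (G : WeightedGraph V E) (e : E) (x : V) :
    ((G.incidence ℤ e x : ℤ) : R) = G.incidence R e x := by
  simp only [incidence, Pi.sub_apply, Pi.single_apply]
  split_ifs <;> simp

theorem laplacian_apply (G : WeightedGraph V E) (x y : V) :
    G.laplacian x y = ∑ e ∈ G.edges, G.weight e * (G.incidence ℝ e x * G.incidence ℝ e y) := by
  have hterm : ∀ e, G.weight e * (G.incidence ℝ e x * G.incidence ℝ e y) =
      if x = y then (if x ∈ G.ends e then G.weight e else 0)
      else -(if G.ends e = s(x, y) then G.weight e else 0) := by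
    intro e
    obtain ⟨u, v, huv, he, hinc⟩ := G.exists_incidence_eq ℝ e
    rw [he, hinc]
    simp only [Pi.sub_apply, Pi.single_apply, Sym2.mem_iff, Sym2.eq_iff]
    grind
  simp only [hterm, laplacian, degree, Matrix.of_apply]
  split_ifs
  · rw [Finset.sum_filter]
  · rw [Finset.sum_filter, Finset.sum_neg_distrib]

theorem sum_incidence [Fintype V] (G : WeightedGraph V E) (e : E) :
    ∑ x, G.incidence ℝ e x = 0 := by
  obtain ⟨u, v, -, -, hinc⟩ := G.exists_incidence_eq ℝ e
  simp [hinc]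

theorem edgeResistance_eq [Fintype V] (G : WeightedGraph V E) (e : E) :
    G.edgeResistance e =
      G.incidence ℝ e ⬝ᵥ (moorePenroseInverse G.laplacian *ᵥ G.incidence ℝ e) := by
  obtain ⟨u, v, -, he, hinc⟩ := G.exists_incidence_eq ℝ e
  rw [edgeResistance, he, hinc]
  rfl

theorem laplacian_transpose (G : WeightedGraph V E) : G.laplacianᵀ = G.laplacian := by
  ext x y
  simp only [Matrix.transpose_apply, laplacian_apply, mul_comm]

theorem sum_laplacian_mulVec [Fintype V] (G : WeightedGraph V E) (x : V → ℝ) :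
    ∑ u, (G.laplacian *ᵥ x) u = 0 := by
  have h : ∀ v, ∑ u, G.laplacian u v = 0 := by
    intro v
    simp only [laplacian_apply]
    rw [Finset.sum_comm]
    refine Finset.sum_eq_zero fun e _ => ?_
    rw [← Finset.mul_sum, ← Finset.sum_mul, sum_incidence, zero_mul, mul_zero]
  simp only [Matrix.mulVec, dotProduct]
  rw [Finset.sum_comm]
  refine Finset.sum_eq_zero fun v _ => ?_
  rw [← Finset.sum_mul, h, zero_mul]

/-! ### Spanning trees and unimodularity -/

/-- Incidence vectors telescope along a path with signs ±1. Integer coefficients are essential: they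
yield an integer inverse below. -/
theorem single_sub_single_mem_span (G : WeightedGraph V E) (S : Set E) {r v : V}
    (h : (SimpleGraph.fromEdgeSet (G.ends '' S)).Reachable r v) :
    (Pi.single v 1 - Pi.single r 1 : V → ℤ) ∈ Submodule.span ℤ (G.incidence ℤ '' S) := by
  obtain ⟨p⟩ := h
  induction p with
  | nil => simp
  | @cons a b c hab _ ih =>
    obtain ⟨⟨e, heS, he⟩, -⟩ := (SimpleGraph.fromEdgeSet_adj _).1 hab
    have hmem : G.incidence ℤ e ∈ Submodule.span ℤ (G.incidence ℤ '' S) :=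
      Submodule.subset_span ⟨e, heS, rfl⟩
    obtain ⟨u, v, -, he', hinc⟩ := G.exists_incidence_eq ℤ e
    rw [← sub_add_sub_cancel _ (Pi.single b 1 : V → ℤ)]
    refine add_mem ih ?_
    rw [he', Sym2.eq_iff] at he
    rcases he with ⟨rfl, rfl⟩ | ⟨rfl, rfl⟩
    · rw [← neg_sub, ← hinc]
      exact neg_mem hmem
    · rwa [← hinc]

variable [Fintype V]

/-- The reduced Laplacian of the edge set `S` with unit weights, the vertex `r` being removed. -/
noncomputable def unitReducedLaplacian (R : Type*) [Ring R] (G : WeightedGraph V E) (r : V)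
    (S : Finset E) : Matrix {x // x ≠ r} {x // x ≠ r} R :=
  Matrix.of fun i j => ∑ e ∈ S, G.incidence R e i * G.incidence R e j

/-- The incidence matrix `M` of `S` without column `r` is square. Each `χ_i - χ_r` is an integer
combination of incidence vectors and becomes a unit vector once the coordinate `r` is dropped, so
`M` has an integer left inverse. Thus `det M = ±1` and `det (Mᵀ M) = 1`. -/
theorem det_unitReducedLaplacian_of_connected (G : WeightedGraph V E) (r : V) (S : Finset E)
    (hcard : S.card = Fintype.card {x // x ≠ r})
    (h : (SimpleGraph.fromEdgeSet (G.ends '' S)).Connected) :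
    (G.unitReducedLaplacian ℝ r S).det = 1 := by
  have σ : {x // x ≠ r} ≃ S := Fintype.equivOfCardEq (by simp [hcard])
  let M : Matrix {x // x ≠ r} {x // x ≠ r} ℤ := Matrix.of fun i j => G.incidence ℤ (σ i) j
  have hM : G.unitReducedLaplacian ℝ r S = (Mᵀ * M).map (Int.castRingHom ℝ) := by
    ext i j
    simp only [unitReducedLaplacian, Matrix.of_apply, Matrix.map_apply, Matrix.mul_apply,
      Matrix.transpose_apply, M, eq_intCast, Int.cast_sum, Int.cast_mul, intCast_incidence]
    rw [σ.sum_comp (fun e : S => G.incidence ℝ (e : E) i * G.incidence ℝ (e : E) j),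
      Finset.sum_coe_sort S (fun e => G.incidence ℝ e i * G.incidence ℝ e j)]
  have hrow : ∀ i : {x // x ≠ r}, ∃ c : {x // x ≠ r} → ℤ, c ᵥ* M = Pi.single i 1 := by
    intro i
    have hi := G.single_sub_single_mem_span S (h.preconnected r i)
    rw [Submodule.mem_span_image_finset_iff_exists_fun'] at hi
    obtain ⟨c, hc⟩ := hi
    refine ⟨fun k => c (σ k), ?_⟩
    ext j
    have hj := congrFun hc j
    simp only [Matrix.vecMul, dotProduct, M, Matrix.of_apply]
    rw [σ.sum_comp (fun e : S => c (e : E) * G.incidence ℤ (e : E) j),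
      Finset.sum_coe_sort S (fun e => c e * G.incidence ℤ e j)]
    simp only [Finset.sum_apply, Pi.smul_apply, smul_eq_mul, Pi.sub_apply] at hj
    rw [hj]
    simp [Pi.single_apply, Subtype.ext_iff, j.2]
  choose c hc using hrow
  have hNM : Matrix.of c * M = 1 := by
    ext i j
    rw [Matrix.mul_apply_eq_vecMul]
    exact (congrFun (hc i) j).trans (by simp [Matrix.one_apply, Pi.single_apply, eq_comm])
  have hunit : IsUnit M.det :=
    IsUnit.of_mul_eq_one_right _ (by rw [← Matrix.det_mul, hNM, Matrix.det_one])
  rw [hM, ← RingHom.mapMatrix_apply, ← RingHom.map_det, Matrix.det_mul, Matrix.det_transpose,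
    ← sq, Int.isUnit_sq hunit, map_one]

/-- The indicator of the vertices not reachable from `r` is constant along every edge of `S` and
vanishes at `r`, so its restriction is a nonzero kernel vector. -/
theorem det_unitReducedLaplacian_of_not_connected (G : WeightedGraph V E) (r : V) (S : Finset E)
    (h : ¬ (SimpleGraph.fromEdgeSet (G.ends '' S)).Connected) :
    (G.unitReducedLaplacian ℝ r S).det = 0 := by
  classical
  set H := SimpleGraph.fromEdgeSet (G.ends '' (S : Set E)) with hH
  obtain ⟨z, hz⟩ : ∃ z, ¬ H.Reachable r z := by
    by_contra! hall
    exact h ((SimpleGraph.connected_iff _).2 ⟨fun a b => (hall a).symm.trans (hall b), ⟨r⟩⟩)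
  let x : V → ℝ := fun v => if H.Reachable r v then 0 else 1
  have hxr : x r = 0 := if_pos (SimpleGraph.Reachable.refl r)
  have hx : ∀ e ∈ S, ∑ j : {y // y ≠ r}, G.incidence ℝ e j * x j = 0 := by
    intro e he
    have hfull : ∑ j : {y // y ≠ r}, G.incidence ℝ e j * x j = ∑ v, G.incidence ℝ e v * x v := by
      rw [Fintype.sum_eq_add_sum_subtype_ne _ r, hxr, mul_zero, zero_add]
    obtain ⟨u, v, huv, hends, hinc⟩ := G.exists_incidence_eq ℝ e
    have hadj : H.Adj u v := (SimpleGraph.fromEdgeSet_adj _).2 ⟨⟨e, he, hends⟩, huv⟩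
    have hiff : H.Reachable r u ↔ H.Reachable r v :=
      ⟨fun hu => hu.trans hadj.reachable, fun hv => hv.trans hadj.symm.reachable⟩
    rw [hfull, hinc]
    simp only [Pi.sub_apply, sub_mul, Finset.sum_sub_distrib, Pi.single_apply, ite_mul, one_mul,
      zero_mul, Finset.sum_ite_eq', Finset.mem_univ, if_true, x, hiff, sub_self]
  refine Matrix.exists_mulVec_eq_zero_iff.1 ⟨fun j => x j, fun h0 => ?_, ?_⟩
  · have hzr : z ≠ r := by
      rintro rfl
      exact hz (SimpleGraph.Reachable.refl z)
    have := congrFun h0 ⟨z, hzr⟩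
    simp [x, hz] at this
  · ext i
    simp only [Matrix.mulVec, dotProduct, unitReducedLaplacian, Matrix.of_apply, Finset.sum_mul,
      Pi.zero_apply]
    rw [Finset.sum_comm]
    refine Finset.sum_eq_zero fun e he => ?_
    simp only [mul_assoc]
    rw [← Finset.mul_sum, hx e he, mul_zero]

/-- Connectedness needs at least `|V| - 1` distinct endpoint pairs, so a connected `S` of exactly
that size can contain neither parallel edges nor cycles. -/
theorem isSpanningTree_iff (G : WeightedGraph V E) (r : V) (S : Finset E) :
    G.IsSpanningTree S ↔ S ⊆ G.edges ∧ S.card = Fintype.card {x // x ≠ r} ∧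
      (SimpleGraph.fromEdgeSet (G.ends '' S)).Connected := by
  classical
  have hV : Fintype.card {x // x ≠ r} + 1 = Fintype.card V := by
    have : 0 < Fintype.card V := Fintype.card_pos_iff.2 ⟨r⟩
    rw [Fintype.card_subtype_compl, Fintype.card_subtype_eq]
    omega
  have hedge : (SimpleGraph.fromEdgeSet (G.ends '' (S : Set E))).edgeSet = G.ends '' S := by
    rw [SimpleGraph.edgeSet_fromEdgeSet, sdiff_eq_left, Set.disjoint_left]
    rintro _ ⟨e, -, rfl⟩
    exact G.ends_not_isDiag e
  have hcard : Nat.card (SimpleGraph.fromEdgeSet (G.ends '' (S : Set E))).edgeSet =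
      (S.image G.ends).card := by
    rw [hedge, ← Finset.coe_image, Nat.card_coe_set_eq, Set.ncard_coe_finset]
  unfold IsSpanningTree
  rw [SimpleGraph.isTree_iff_connected_and_card, hcard, Nat.card_eq_fintype_card]
  refine and_congr_right fun _ => ⟨?_, ?_⟩
  · rintro ⟨hinj, hconn, hc⟩
    rw [Finset.card_image_of_injOn hinj] at hc
    exact ⟨by omega, hconn⟩
  · rintro ⟨hS, hconn⟩
    have h1 := hconn.card_vert_le_card_edgeSet_add_one
    rw [hcard, Nat.card_eq_fintype_card] at h1
    have h2 : (S.image G.ends).card ≤ S.card := Finset.card_image_le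
    exact ⟨Finset.card_image_iff.1 (by omega), hconn, by omega⟩

/-! ### The matrix-tree theorem -/

/-- The Laplacian with the row and the column of the vertex `r` removed. -/
def reducedLaplacian (G : WeightedGraph V E) (r : V) : Matrix {x // x ≠ r} {x // x ≠ r} ℝ :=
  G.laplacian.submatrix Subtype.val Subtype.val

theorem det_reducedLaplacian (G : WeightedGraph V E) (r : V) :
    (G.reducedLaplacian r).det = ∑ T ∈ G.spanningTrees, ∏ e ∈ T, G.weight e := by
  classical
  have hL : G.reducedLaplacian r = Matrix.of fun i j =>
      ∑ e ∈ G.edges, G.weight e * (G.incidence ℝ e i.1 * G.incidence ℝ e j.1) := by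
    ext i j
    simp [reducedLaplacian, laplacian_apply]
  have htrees : G.spanningTrees = (G.edges.powersetCard (Fintype.card {x // x ≠ r})).filter fun S : Finset E =>
      (SimpleGraph.fromEdgeSet (G.ends '' S)).Connected := by
    ext S
    simp only [spanningTrees, Finset.mem_filter, Finset.mem_powerset, Finset.mem_powersetCard,
      G.isSpanningTree_iff r]
    tauto
  rw [hL, det_sum_smul_eq_sum_powersetCard G.edges G.weight
    (fun e (i : {x // x ≠ r}) => G.incidence ℝ e i), htrees, Finset.sum_filter]
  refine Finset.sum_congr rfl fun S hS => ?_
  change _ * (G.unitReducedLaplacian ℝ r S).det = _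
  split_ifs with hconn
  · rw [G.det_unitReducedLaplacian_of_connected r S (Finset.mem_powersetCard.1 hS).2 hconn, mul_one]
  · rw [G.det_unitReducedLaplacian_of_not_connected r S hconn, mul_zero]

/-! ### Effective resistance and the rank-one update -/

/-- Extending the reduced solution by potential 0 at `r` gives `x` with `L x = χ_u - χ_v`. Then `(L
x)ᵀ L⁺ (L x) = xᵀ L x` by symmetry of `L` and `L L⁺ L = L` alone, without describing the kernel of
`L`. -/
theorem edgeResistance_eq_inv_reducedLaplacian (G : WeightedGraph V E) (r : V) (f : E)
    (h : IsUnit (G.reducedLaplacian r).det) :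
    G.edgeResistance f = (fun i : {x // x ≠ r} => G.incidence ℝ f i) ⬝ᵥ
      ((G.reducedLaplacian r)⁻¹ *ᵥ fun i => G.incidence ℝ f i) := by
  set b : {x // x ≠ r} → ℝ := fun i => G.incidence ℝ f i with hb
  set y := (G.reducedLaplacian r)⁻¹ *ᵥ b with hy
  have hLy : G.reducedLaplacian r *ᵥ y = b := by
    rw [hy, Matrix.mulVec_mulVec, Matrix.mul_nonsing_inv _ h, Matrix.one_mulVec]
  let x : V → ℝ := fun v => if hv : v ≠ r then y ⟨v, hv⟩ else 0
  have hxr : x r = 0 := by simp [x]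
  have hxy : ∀ i : {v // v ≠ r}, x i = y i := fun i => by simp [x, i.2]
  have hne : ∀ v ≠ r, (G.laplacian *ᵥ x) v = G.incidence ℝ f v := by
    intro v hv
    have h1 := congrFun hLy ⟨v, hv⟩
    simp only [Matrix.mulVec, dotProduct, reducedLaplacian, Matrix.submatrix_apply, hb] at h1 ⊢
    rw [Fintype.sum_eq_add_sum_subtype_ne _ r, hxr, mul_zero, zero_add]
    simpa only [hxy] using h1
  have hLx : G.laplacian *ᵥ x = G.incidence ℝ f := by
    funext v
    by_cases hv : v = r
    · subst hv
      -- The deleted equation at `r` follows from the others, since both sides have coordinate sum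
      -- zero.
      have h1 := G.sum_laplacian_mulVec x
      have h2 := G.sum_incidence f
      rw [Fintype.sum_eq_add_sum_subtype_ne _ v] at h1 h2
      rw [Finset.sum_congr rfl fun i _ => hne i.1 i.2] at h1
      linarith
    · exact hne v hv
  calc G.edgeResistance f
      = (G.laplacian *ᵥ x) ⬝ᵥ (moorePenroseInverse G.laplacian *ᵥ (G.laplacian *ᵥ x)) := by
        rw [edgeResistance_eq, hLx]
    _ = x ⬝ᵥ (G.laplacian *ᵥ x) := by
        rw [dotProduct_comm, Matrix.dotProduct_mulVec, ← Matrix.mulVec_transpose,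
          laplacian_transpose, Matrix.mulVec_mulVec, Matrix.mulVec_mulVec,
          (moorePenroseInverse_spec G.laplacian).mul_mul_left, dotProduct_comm]
    _ = b ⬝ᵥ y := by
        rw [hLx, dotProduct_comm]
        simp only [dotProduct, hb]
        rw [Fintype.sum_eq_add_sum_subtype_ne _ r, hxr, mul_zero, zero_add]
        simp only [hxy]

omit [Fintype V] in
theorem reducedLaplacian_update [DecidableEq E] (G : WeightedGraph V E) (r : V) (lam : ℝ) (f : E)
    (hf : G.UpdateValid lam f) :
    (G.update lam f hf).reducedLaplacian r = G.reducedLaplacian r +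
      Matrix.replicateCol Unit (fun i : {x // x ≠ r} => lam * G.incidence ℝ f i) *
        Matrix.replicateRow Unit (fun i : {x // x ≠ r} => G.incidence ℝ f i) := by
  ext i j
  have hsum : ∀ g : E → ℝ, ∑ e ∈ insert f G.edges, (G.update lam f hf).weight e * g e =
      ∑ e ∈ G.edges, G.weight e * g e + lam * g f := by
    intro g
    have hne : ∀ e ∈ G.edges.erase f, (G.update lam f hf).weight e * g e = G.weight e * g e :=
      fun e he => by
        simp only [update, Function.update_of_ne (Finset.ne_of_mem_erase he)]
    by_cases hmem : f ∈ G.edges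
    · rw [Finset.insert_eq_of_mem hmem, ← Finset.add_sum_erase _ _ hmem,
        ← Finset.add_sum_erase G.edges (fun e => G.weight e * g e) hmem, Finset.sum_congr rfl hne]
      simp only [update, Function.update_self, if_pos hmem]
      ring
    · rw [Finset.erase_eq_of_notMem hmem] at hne
      rw [Finset.sum_insert hmem, Finset.sum_congr rfl hne]
      simp only [update, Function.update_self, if_neg hmem]
      ring
  have h := hsum fun e => G.incidence ℝ e i * G.incidence ℝ e j
  simp only [reducedLaplacian, Matrix.submatrix_apply, Matrix.add_apply, Matrix.mul_apply,
    Matrix.replicateCol_apply, Matrix.replicateRow_apply, Finset.univ_unique, Finset.sum_singleton,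
    laplacian_apply]
  rw [mul_assoc]
  exact h

end WeightedGraph

open WeightedGraph in
theorem mainTheorem5 {V E : Type*} [Fintype V] [DecidableEq V] [DecidableEq E]
    (G : WeightedGraph V E) (hG : G.Connected)
    (lam : ℝ) (f : E) (hf : G.UpdateValid lam f) (hG' : (G.update lam f hf).Connected) :
    0 < 1 + lam * G.edgeResistance f ∧
      (G.update lam f hf).stPotential
        = G.stPotential + Real.log (1 + lam * G.edgeResistance f) := by
  obtain ⟨r⟩ := hG.nonempty
  have hpos := G.sum_spanningTrees_pos hG
  have hpos' := (G.update lam f hf).sum_spanningTrees_pos hG'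
  have hunit : IsUnit (G.reducedLaplacian r).det := by
    rw [det_reducedLaplacian]
    exact hpos.ne'.isUnit
  have hmul : ∑ T ∈ (G.update lam f hf).spanningTrees, ∏ e ∈ T, (G.update lam f hf).weight e =
      (∑ T ∈ G.spanningTrees, ∏ e ∈ T, G.weight e) * (1 + lam * G.edgeResistance f) := by
    rw [← det_reducedLaplacian _ r, ← det_reducedLaplacian _ r, reducedLaplacian_update,
      Matrix.det_add_replicateCol_mul_replicateRow hunit,
      G.edgeResistance_eq_inv_reducedLaplacian r f hunit]
    congr 1
    -- The matrix determinant lemma leaves a 1×1 determinant, read off as a scalar.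
    rw [Matrix.det_unique, Matrix.add_apply, Matrix.one_apply_eq, Matrix.mul_assoc,
      ← Matrix.replicateCol_mulVec, Matrix.replicateRow_mul_replicateCol_apply]
    rw [← smul_eq_mul lam, ← dotProduct_smul, ← Matrix.mulVec_smul]
    rfl
  rw [hmul] at hpos'
  -- The factor is the ratio of two positive tree sums; this covers negative `lam` as well.
  have hfac := (mul_pos_iff_of_pos_left hpos).1 hpos'
  refine ⟨hfac, ?_⟩
  rw [stPotential, stPotential, hmul, Real.log_mul hpos.ne' hfac.ne']
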